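/- Let $d\ge 1$, $g\ge 0$, and let $G$ be a finite polygon decomposition (vertices $\mathcal G_0$, edges $\mathcal G_1$, faces $\mathcal G_2$) of a connected closed oriented surface of genus $g$, such that every edge lies between two different vertices and is shared by two different faces. Each edge has a fixed orientation; faces inherit the orientation of the surface. Let $\mathcal H_G=\bigotimes_{e\in\mathcal G_1}\mathbb C^d$, where $\mathbb C^d$ has orthonormal basis $\{l_i\}_{i\in\mathbb Z_d}$, and let $Xl_i=l_{i+1}$, $Zl_i=\omega^i l_i$ with $\omega=e^{2\pi \mathrm i/d}$. For a vertex $v$ let $a_v=\prod_{e\ni v}X_e^{\pm1}$ ($+$ if $e$ is incoming to $v$, $-$ if it is outgoing), and for a face $f$ let $b_f=\prod_{e\in f}Z_e^{\pm1}$ ($+$ if $e$ has the positive orientation with respect to $f$, $-$ otherwise). Put $A_v=\frac1d\sum_{j=0}^{d-1}a_v^j$, $B_f=\frac1d\sum_{j=0}^{d-1}b_f^j$ and $H_G=-\sum_vA_v-\sum_fB_f$, and let $\mathcal S_G$ be the ground state space of $H_G$, i.e. its eigenspace for the lowest eigenvalue. For a $1$-cochain $\gamma=(\gamma_e)\in(\mathbb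 Z_d)^{\mathcal G_1}$ let $X_\gamma=\prod_eX_e^{\gamma_e}$. Let $K$ be the finite group generated by $\{a_v: v\in\mathcal G_0\}$, let $\Omega=\bigotimes_e l_0$, and let $$\Psi_0=|K|^{-1/2}\sum_{h\in K}h\,\Omega .$$ The first cohomology group $H^1(G;\mathbb Z_d)$ (cocycles modulo coboundaries) is isomorphic to $(\mathbb Z_d)^g\oplus(\mathbb Z_d)^g$. Moreover, for every group isomorphism $\theta:(\mathbb Z_d)^g\oplus(\mathbb Z_d)^g\to H^1(G;\mathbb Z_d)$ and every choice of cocycles $\gamma_{\alpha,\beta}$ representing the classes $\theta(\alpha,\beta)$, writing $X_{\alpha,\beta}=X_{\gamma_{\alpha,\beta}}$, the family $$\Psi_{\alpha,\beta}=X_{\alpha,\beta}\Psi_0,\qquad \alpha,\beta\in(\mathbb Z_d)^g,$$ is an orthonormal basis of $\mathcal S_G$. -/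

import Mathlib

noncomputable section

namespace KitaevModel

/-! ### Polygon decompositions of closed oriented surfaces -/

/-- The orientation-reversing involution on the oriented edges (darts).  The dart `(e, true)` is the
edge `e` with its fixed orientation, and `(e, false)` is `e` with the opposite orientation. -/
def dartRev (E : Type*) : Equiv.Perm (E × Bool) where
  toFun x := (x.1, !x.2)
  invFun x := (x.1, !x.2)
  left_inv x := by simp
  right_inv x := by simp

/-- A polygon decomposition of a connected closed oriented surface, with vertices `V`, edges `E`
(each carrying a fixed orientation) and faces `F`, encoded as a combinatorial map (rotation system):
`rot` sends a dart to the next dart, counterclockwise, with the same origin.  The vertices are the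
cycles of `rot`.  Walking along a dart `x` and then along `rot⁻¹ (dartRev x)` one follows
counterclockwise the boundary of the face on the left-hand side of `x`, so that the faces are the
cycles of `rot⁻¹ * dartRev`.  The surface is obtained by gluing one polygonal disc along each of
these cycles. -/
structure PolygonDecomposition (V E F : Type*) where
  /-- next dart, counterclockwise, around the common origin -/
  rot : Equiv.Perm (E × Bool)
  /-- the origin of a dart -/
  org : E × Bool → V
  /-- the face on the left-hand side of a dart -/
  left : E × Bool → F
  org_surjective : Function.Surjective org
  left_surjective : Function.Surjective left
  org_eq_iff : ∀ x y, org x = org y ↔ rot.SameCycle x y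
  left_eq_iff : ∀ x y, left x = left y ↔ (rot⁻¹ * dartRev E).SameCycle x y
  /-- there is at least one edge -/
  nonempty : Nonempty E
  /-- the surface is connected -/
  connected : ∀ x y, ∃ w ∈ Subgroup.closure {rot, dartRev E}, w x = y
  /-- an edge lies between two different vertices -/
  ends_ne : ∀ e, org (e, true) ≠ org (e, false)
  /-- an edge is shared by two different faces -/
  faces_ne : ∀ e, left (e, true) ≠ left (e, false)

namespace PolygonDecomposition

variable {V E F : Type*} (G : PolygonDecomposition V E F)

/-- The vertex from which the edge `e` is outgoing. -/
def src (e : E) : V := G.org (e, true)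

/-- The vertex into which the edge `e` is incoming. -/
def tgt (e : E) : V := G.org (e, false)

/-- The underlying surface has genus `g`: `|V| - |E| + |F| = 2 - 2g`. -/
def HasGenus (_G : PolygonDecomposition V E F) [Fintype V] [Fintype E] [Fintype F] (g : ℕ) :
    Prop :=
  (Fintype.card V : ℤ) - Fintype.card E + Fintype.card F = 2 - 2 * g

variable (d : ℕ)

/-- The `1`-cochain of the edges at `v`: the sign of `e` is `+1` if `e` is incoming to `v`, `-1` if
`e` is outgoing from `v`, and `0` if `v` is not a vertex of `e`. -/
def star [DecidableEq V] (v : V) : E → ZMod d := fun e =>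
  (if G.tgt e = v then 1 else 0) - (if G.src e = v then 1 else 0)

/-- The `1`-chain `∂f`: the sign of `e` is `+1` (`-1`) if `e` has the positive (negative)
orientation with respect to the face `f`, and `0` if `e` is not an edge of `f`. -/
def faceBoundary [DecidableEq F] (f : F) : E → ZMod d := fun e =>
  (if G.left (e, true) = f then 1 else 0) - (if G.left (e, false) = f then 1 else 0)

/-- The coboundary `C⁰ → C¹`, i.e. the boundary map from the faces to the edges of the dual
decomposition; it sends `v` to `star v`. -/
def coboundary₀ [Fintype V] [DecidableEq V] : (V → ZMod d) →ₗ[ZMod d] (E → ZMod d) where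
  toFun u := ∑ v, u v • G.star d v
  map_add' u w := by simp [add_smul, Finset.sum_add_distrib]
  map_smul' r u := by simp [mul_smul, Finset.smul_sum]

/-- The coboundary `C¹ → C²`, i.e. the boundary map from the edges to the vertices of the dual
decomposition: the dual edge of `e` goes from the face on the right of `e` to the one on its left. -/
def coboundary₁ [Fintype E] [DecidableEq F] : (E → ZMod d) →ₗ[ZMod d] (F → ZMod d) where
  toFun c f := ∑ e, c e * G.faceBoundary d f e
  map_add' u w := by ext; simp [add_mul, Finset.sum_add_distrib]
  map_smul' r u := by ext; simp [mul_assoc, Finset.mul_sum]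

variable [Fintype V] [Fintype E] [DecidableEq V] [DecidableEq F]

/-- The group of `1`-cocycles with coefficients in `ℤ/d`. -/
def cocycles : Submodule (ZMod d) (E → ZMod d) := LinearMap.ker (G.coboundary₁ d)

/-- The group of `1`-coboundaries with coefficients in `ℤ/d`. -/
def coboundaries : Submodule (ZMod d) (E → ZMod d) := LinearMap.range (G.coboundary₀ d)

theorem coboundaries_le_cocycles : G.coboundaries d ≤ G.cocycles d := by
  classical
  rintro _ ⟨u, rfl⟩
  have hu : ∀ e, G.coboundary₀ d u e = u (G.tgt e) - u (G.src e) := by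
    intro e
    simp [coboundary₀, star, mul_sub, Finset.sum_sub_distrib]
  rw [cocycles, LinearMap.mem_ker]
  ext f
  change ∑ e, G.coboundary₀ d u e * G.faceBoundary d f e = 0
  let ind : E × Bool → ZMod d := fun x => if G.left x = f then 1 else 0
  have key : ∑ x : E × Bool, ind x * (u (G.org (dartRev E x)) - u (G.org x)) = 0 := by
    simp only [mul_sub, Finset.sum_sub_distrib]
    rw [sub_eq_zero, ← Equiv.sum_comp (G.rot⁻¹ * dartRev E) (fun x => ind x * u (G.org x))]
    refine Finset.sum_congr rfl fun x _ => ?_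
    have h1 : G.left ((G.rot⁻¹ * dartRev E) x) = G.left x :=
      (G.left_eq_iff _ _).2 (Equiv.Perm.sameCycle_apply_left.2 (Equiv.Perm.SameCycle.refl _ _))
    have h2 : G.org ((G.rot⁻¹ * dartRev E) x) = G.org (dartRev E x) := by
      refine (G.org_eq_iff _ _).2 ?_
      rw [Equiv.Perm.mul_apply]
      exact ⟨1, by simp⟩
    simp only [ind, h1, h2]
  rw [Fintype.sum_prod_type] at key
  rw [← key]
  refine Finset.sum_congr rfl fun e _ => ?_
  rw [hu, Fintype.sum_bool]
  simp only [ind, faceBoundary, dartRev, Equiv.coe_fn_mk, Bool.not_true, Bool.not_false, src, tgt]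
  ring

/-- The first cohomology group with coefficients in `ℤ/d`: cocycles modulo coboundaries. -/
abbrev H1 : Type _ := G.cocycles d ⧸ (G.coboundaries d).submoduleOf (G.cocycles d)

/-- The cohomology class of a cocycle. -/
def cohomologyClass (c : G.cocycles d) : G.H1 d := Submodule.Quotient.mk c

end PolygonDecomposition

/-! ### The quantum spin system -/

/-- The total Hilbert space `⨂_{e ∈ E} ℂ^d`, through its orthonormal product basis
`⨂_e l_{k e}`, indexed by the configurations `k : E → ℤ/d`. -/
abbrev StateSpace (E : Type*) [Fintype E] [DecidableEq E] (d : ℕ) [NeZero d] : Type _ :=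
  EuclideanSpace ℂ (E → ZMod d)

/-- The primitive root of unity `ω = exp (2πi / d)`. -/
def omega (d : ℕ) : unitary ℂ :=
  ⟨Complex.exp (2 * Real.pi * Complex.I / d), by
    rw [Unitary.mem_iff_self_mul_star]
    have h : star (Complex.exp (2 * Real.pi * Complex.I / d))
        = Complex.exp (-(2 * Real.pi * Complex.I / d)) := by
      rw [Complex.star_def, ← Complex.exp_conj]
      simp [neg_div, Complex.conj_ofNat]
    rw [h, ← Complex.exp_add]
    simp⟩

section Operators

variable {E : Type*} [Fintype E] [DecidableEq E] {d : ℕ} [NeZero d]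

/-- The product basis vector `⨂_e l_{k e}`. -/
def productState (k : E → ZMod d) : StateSpace E d := EuclideanSpace.single k 1

/-- The operator `X_e`, acting on the spin at `e` as `X l_i = l_{i+1}`. -/
def siteX (e : E) : StateSpace E d ≃ₗᵢ[ℂ] StateSpace E d :=
  LinearIsometryEquiv.piLpCongrLeft 2 ℂ ℂ (Equiv.addRight (Pi.single e 1))

/-- The operator `Z_e`, acting on the spin at `e` as `Z l_i = ω^i l_i`. -/
def siteZ (e : E) : StateSpace E d ≃ₗᵢ[ℂ] StateSpace E d :=
  LinearIsometryEquiv.piLpCongrRight 2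
    (fun k : E → ZMod d => (omega d ^ (k e).val) • LinearIsometryEquiv.refl ℂ ℂ)

theorem op_mul_apply (u w : StateSpace E d ≃ₗᵢ[ℂ] StateSpace E d) (ψ : StateSpace E d) :
    (u * w) ψ = u (w ψ) := rfl

theorem siteX_apply (e : E) (ψ : StateSpace E d) (k : E → ZMod d) :
    siteX e ψ k = ψ (k - Pi.single e 1) := by
  simp [siteX, LinearIsometryEquiv.piLpCongrLeft_apply, Equiv.piCongrLeft', sub_eq_add_neg]

theorem siteZ_apply (e : E) (ψ : StateSpace E d) (k : E → ZMod d) :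
    siteZ e ψ k = (omega d : ℂ) ^ (k e).val * ψ k := by
  simp [siteZ, LinearIsometryEquiv.piLpCongrRight_apply]

theorem siteX_productState (e : E) (k : E → ZMod d) :
    siteX e (productState k) = productState (k + Pi.single e 1) := by
  simp [siteX, productState]

theorem siteZ_productState (e : E) (k : E → ZMod d) :
    siteZ e (productState k) = (omega d : ℂ) ^ (k e).val • productState k := by
  ext k'
  rw [siteZ_apply]
  by_cases h : k' = k
  · subst h; simp [productState]
  · simp [productState, h]

theorem siteX_commute (e e' : E) :
    Commute (siteX e : StateSpace E d ≃ₗᵢ[ℂ] StateSpace E d) (siteX e') := by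
  ext ψ k
  simp only [op_mul_apply, siteX_apply, sub_right_comm]

theorem siteZ_commute (e e' : E) :
    Commute (siteZ e : StateSpace E d ≃ₗᵢ[ℂ] StateSpace E d) (siteZ e') := by
  ext ψ k
  simp only [op_mul_apply, siteZ_apply, mul_left_comm]

theorem siteX_pairwise (γ : E → ZMod d) (s : Set E) :
    s.Pairwise (Function.onFun Commute fun e =>
      (siteX e : StateSpace E d ≃ₗᵢ[ℂ] StateSpace E d) ^ (γ e).val) :=
  fun e _ e' _ _ => (siteX_commute e e').pow_pow _ _

/-- `X_γ = ∏_e X_e^{γ_e}` for a `1`-cochain `γ`. -/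
def opX (γ : E → ZMod d) : StateSpace E d ≃ₗᵢ[ℂ] StateSpace E d :=
  Finset.univ.noncommProd (fun e => siteX e ^ (γ e).val)
    (siteX_pairwise γ _)

theorem siteZ_pairwise (γ : E → ZMod d) (s : Set E) :
    s.Pairwise (Function.onFun Commute fun e =>
      (siteZ e : StateSpace E d ≃ₗᵢ[ℂ] StateSpace E d) ^ (γ e).val) :=
  fun e _ e' _ _ => (siteZ_commute e e').pow_pow _ _

/-- `Z_γ = ∏_e Z_e^{γ_e}` for a `1`-chain `γ`. -/
def opZ (γ : E → ZMod d) : StateSpace E d ≃ₗᵢ[ℂ] StateSpace E d :=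
  Finset.univ.noncommProd (fun e => siteZ e ^ (γ e).val)
    (siteZ_pairwise γ _)

theorem opX_apply (γ : E → ZMod d) (ψ : StateSpace E d) (k : E → ZMod d) :
    opX γ ψ k = ψ (k - γ) := by
  have hpow : ∀ (n : ℕ) (e : E) (φ : StateSpace E d) (k : E → ZMod d),
      (siteX e ^ n) φ k = φ (k - Pi.single e (n : ZMod d)) := by
    intro n e
    induction n with
    | zero => intro φ k; simp
    | succ n ih =>
      intro φ k
      rw [pow_succ, op_mul_apply, ih, siteX_apply]
      rw [sub_sub, ← Pi.single_add]
      push_cast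
      rfl
  have hs : ∀ (s : Finset E) (φ : StateSpace E d) (k : E → ZMod d),
      (s.noncommProd (fun e => siteX e ^ (γ e).val)
        (siteX_pairwise γ _) :
          StateSpace E d ≃ₗᵢ[ℂ] StateSpace E d) φ k
        = φ (k - ∑ e ∈ s, Pi.single e (γ e)) := by
    intro s
    induction s using Finset.induction_on with
    | empty => intro φ k; simp
    | insert a s ha ih =>
      intro φ k
      rw [Finset.noncommProd_insert_of_notMem _ _ _ _ ha, op_mul_apply, hpow, ih,
        Finset.sum_insert ha, sub_sub, ZMod.natCast_zmod_val]
  rw [opX, hs, Finset.univ_sum_single]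

theorem opZ_apply (γ : E → ZMod d) (ψ : StateSpace E d) (k : E → ZMod d) :
    opZ γ ψ k = (omega d : ℂ) ^ (∑ e, (k e).val * (γ e).val) * ψ k := by
  have hpow : ∀ (n : ℕ) (e : E) (φ : StateSpace E d) (k : E → ZMod d),
      (siteZ e ^ n) φ k = (omega d : ℂ) ^ ((k e).val * n) * φ k := by
    intro n e
    induction n with
    | zero => intro φ k; simp
    | succ n ih =>
      intro φ k
      rw [pow_succ, op_mul_apply, ih, siteZ_apply, ← mul_assoc, ← pow_add,
        mul_add_one]
  have hs : ∀ (s : Finset E) (φ : StateSpace E d) (k : E → ZMod d),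
      (s.noncommProd (fun e => siteZ e ^ (γ e).val)
        (siteZ_pairwise γ _) :
          StateSpace E d ≃ₗᵢ[ℂ] StateSpace E d) φ k
        = (omega d : ℂ) ^ (∑ e ∈ s, (k e).val * (γ e).val) * φ k := by
    intro s
    induction s using Finset.induction_on with
    | empty => intro φ k; simp
    | insert a s ha ih =>
      intro φ k
      rw [Finset.noncommProd_insert_of_notMem _ _ _ _ ha, op_mul_apply, hpow, ih,
        Finset.sum_insert ha, pow_add, mul_assoc]
  rw [opZ, hs]

/-- `X` as a homomorphism from the cochain group to the unitary operators. -/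
def opXHom : Multiplicative (E → ZMod d) →* (StateSpace E d ≃ₗᵢ[ℂ] StateSpace E d) where
  toFun γ := opX γ.toAdd
  map_one' := by ext ψ k; simp [opX_apply]
  map_mul' γ γ' := by
    ext ψ k
    simp [opX_apply, sub_sub, op_mul_apply]

/-- The average `(1/d) ∑_{j=0}^{d-1} u^j` of the powers of a unitary operator. -/
def powerAverage (u : StateSpace E d ≃ₗᵢ[ℂ] StateSpace E d) : Module.End ℂ (StateSpace E d) :=
  (1 / (d : ℂ)) • ∑ j ∈ Finset.range d, (u ^ j).toLinearEquiv.toLinearMap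

/-- The lowest eigenvalue of a Hamiltonian. -/
def groundEnergy (H : Module.End ℂ (StateSpace E d)) : ℝ :=
  sInf {x : ℝ | H.HasEigenvalue (x : ℂ)}

end Operators

namespace PolygonDecomposition

variable {V E F : Type*} (G : PolygonDecomposition V E F)
variable [Fintype E] [DecidableEq E] (d : ℕ) [NeZero d]

/-- `a_v = ∏_{e ∋ v} X_e^{ε(e)}`, with `ε(e) = 1` for incoming and `ε(e) = -1` for outgoing
edges. -/
def vertexUnitary [DecidableEq V] (v : V) : StateSpace E d ≃ₗᵢ[ℂ] StateSpace E d :=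
  opX (G.star d v)

/-- `b_f = ∏_{e ∈ f} Z_e^{ε(e)} = Z_{∂f}`. -/
def faceUnitary [DecidableEq F] (f : F) : StateSpace E d ≃ₗᵢ[ℂ] StateSpace E d :=
  opZ (G.faceBoundary d f)

/-- Kitaev's Hamiltonian `H_G = -∑_v A_v - ∑_f B_f`. -/
def hamiltonian [Fintype V] [Fintype F] [DecidableEq V] [DecidableEq F] :
    Module.End ℂ (StateSpace E d) :=
  -(∑ v, powerAverage (G.vertexUnitary d v)) - ∑ f, powerAverage (G.faceUnitary d f)

/-- The ground state space `S_G`: the eigenspace of `H_G` for its lowest eigenvalue. -/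
def groundStateSpace [Fintype V] [Fintype F] [DecidableEq V] [DecidableEq F] :
    Submodule ℂ (StateSpace E d) :=
  (G.hamiltonian d).eigenspace (groundEnergy (G.hamiltonian d) : ℂ)

/-- The group `K` generated by the operators `a_v`. -/
def vertexGroup [DecidableEq V] : Subgroup (StateSpace E d ≃ₗᵢ[ℂ] StateSpace E d) :=
  Subgroup.closure (Set.range (G.vertexUnitary d))

instance finite_vertexGroup [DecidableEq V] : Finite (G.vertexGroup d) := by
  have h : G.vertexGroup d ≤ (opXHom (E := E) (d := d)).range := by
    rw [vertexGroup, Subgroup.closure_le]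
    rintro _ ⟨v, rfl⟩
    exact ⟨Multiplicative.ofAdd (G.star d v), rfl⟩
  have : Finite (opXHom (E := E) (d := d)).range :=
    Set.finite_range (opXHom (E := E) (d := d))
  exact Finite.of_injective _ (Subgroup.inclusion_injective h)

instance fintype_vertexGroup [DecidableEq V] : Fintype (G.vertexGroup d) := Fintype.ofFinite _

/-- `Ψ₀ = |K|^{-1/2} ∑_{h ∈ K} h Ω`, with `Ω = ⨂_e l_0`. -/
def Psi₀ [DecidableEq V] : StateSpace E d :=
  (((Fintype.card (G.vertexGroup d) : ℝ) ^ (-(1 / 2) : ℝ) : ℝ) : ℂ) •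
    ∑ h : G.vertexGroup d, (h : StateSpace E d ≃ₗᵢ[ℂ] StateSpace E d) (productState 0)

end PolygonDecomposition

end KitaevModel

end

/-!
The complex `0 → ℤ/d → C⁰ → C¹ → C² → ℤ/d → 0`, with the constants on the left and the sum over all
faces on the right, is exact except at `C¹`, by connectedness, and it splits everywhere.  Hence
`H¹ ⊕ C⁰ ⊕ C² ≅ C¹ ⊕ (ℤ/d)²`, so that `H¹` is projective of constant rank
`|E| + 2 - |V| - |F| = 2g`, and such a module over the semilocal ring `ℤ/d` is free.

The Hamiltonian is minus a sum of contractions, so by strict convexity the ground states are the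
common fixed vectors of these contractions as soon as a nonzero one exists, i.e. the common fixed
vectors of the `a_v` and `b_f`.  As functions on `C¹`, the vectors fixed by all `a_v` are those
invariant under translation by coboundaries, and the vectors fixed by all `b_f` are those supported
on the cocycles.  The normalised indicators of the cosets of the coboundaries inside the cocycles
form an orthonormal basis of this space, and `X_γ Ψ₀` is the indicator of the coset of `γ`.
-/

noncomputable section

namespace KitaevModel

/-! ### First cohomology -/

section LinearAlgebra

open Module TensorProduct

variable {R M N N' : Type*} [AddCommGroup M] [AddCommGroup N] [AddCommGroup N']

theorem nonempty_basis_of_prod_linearEquiv [CommRing R] [Finite (MaximalSpectrum R)]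
    [Module R M] [Module R N] [Module R N'] {κ α β : Type*} [Fintype κ] [Fintype α] [Fintype β]
    (b : Basis α R N) (b' : Basis β R N') (e : (M × N) ≃ₗ[R] N')
    (hcard : Fintype.card β = Fintype.card κ + Fintype.card α) :
    Nonempty (Basis κ R M) := by
  have : Module.Finite R N' := .of_basis b'
  have : Projective R N' := .of_basis b'
  have : Projective R M := .of_split (e.toLinearMap ∘ₗ LinearMap.inl R M N)
    (LinearMap.fst R M N ∘ₗ e.symm.toLinearMap) (by ext; simp)
  have : Module.Finite R M := .of_surjective (LinearMap.fst R M N ∘ₗ e.symm.toLinearMap)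
    (Prod.fst_surjective.comp e.symm.surjective)
  have : Module.Finite R N := .of_basis b
  suffices hrank : ∀ P : MaximalSpectrum R,
      finrank (R ⧸ P.1) ((R ⧸ P.1) ⊗[R] M) = Fintype.card κ by
    obtain ⟨c⟩ := nonempty_basis_of_flat_of_finrank_eq R M _ hrank
    exact ⟨c.reindex (Fintype.equivFin κ).symm⟩
  intro P
  let := Ideal.Quotient.field P.1
  have hsum : finrank (R ⧸ P.1) ((R ⧸ P.1) ⊗[R] M) + finrank (R ⧸ P.1) ((R ⧸ P.1) ⊗[R] N)
      = finrank (R ⧸ P.1) ((R ⧸ P.1) ⊗[R] N') := by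
    rw [← finrank_prod, ← (e.baseChange R (R ⧸ P.1) _ _).finrank_eq,
      (TensorProduct.prodRight R (R ⧸ P.1) (R ⧸ P.1) M N).finrank_eq]
  rw [finrank_eq_card_basis (Algebra.TensorProduct.basis (R ⧸ P.1) b),
    finrank_eq_card_basis (Algebra.TensorProduct.basis (R ⧸ P.1) b')] at hsum
  omega

variable [Ring R] [Module R M] [Module R N] [Module R N']

theorem nonempty_linearEquiv_prod_of_retraction (Z B : Submodule R M) (hBZ : B ≤ Z)
    (r : M →ₗ[R] B) (hr : ∀ b : B, r b = b) :
    Nonempty (Z ≃ₗ[R] B × (Z ⧸ B.submoduleOf Z)) :=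
  have hexact : Function.Exact (Submodule.inclusion hBZ) (B.submoduleOf Z).mkQ := by
    rw [LinearMap.exact_iff, Submodule.ker_mkQ, Submodule.range_inclusion]
    rfl
  ⟨(hexact.splitInjectiveEquiv (Submodule.mkQ_surjective _)
    ⟨r ∘ₗ Z.subtype, by ext b; simp [hr]⟩).1⟩

theorem nonempty_linearEquiv_ker_prod_range (f : M →ₗ[R] N) [Projective R (LinearMap.range f)] :
    Nonempty (M ≃ₗ[R] LinearMap.ker f × LinearMap.range f) := by
  obtain ⟨s, hs⟩ := f.rangeRestrict.exists_rightInverse_of_surjective f.range_rangeRestrict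
  have hexact : Function.Exact (LinearMap.ker f).subtype f.rangeRestrict := by
    rw [LinearMap.exact_iff, Submodule.range_subtype, LinearMap.ker_rangeRestrict]
  exact ⟨(hexact.splitSurjectiveEquiv (Submodule.subtype_injective _) ⟨s, hs⟩).1⟩

end LinearAlgebra

namespace PolygonDecomposition

variable {V E F : Type*} (G : PolygonDecomposition V E F)

theorem org_rot (x : E × Bool) : G.org (G.rot x) = G.org x :=
  (G.org_eq_iff _ _).2 (Equiv.Perm.sameCycle_apply_left.2 (Equiv.Perm.SameCycle.refl _ _))

theorem left_dartRev_rot (x : E × Bool) : G.left (dartRev E (G.rot x)) = G.left x :=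
  (G.left_eq_iff _ _).2 ⟨1, by simp [dartRev]⟩

section Connected

variable {α : Type*}

theorem apply_eq_of_rot_of_dartRev {p : E × Bool → α} (hrot : ∀ x, p (G.rot x) = p x)
    (hrev : ∀ x, p (dartRev E x) = p x) (x y : E × Bool) : p x = p y := by
  obtain ⟨w, hw, rfl⟩ := G.connected x y
  induction hw using Subgroup.closure_induction generalizing x with
  | mem w hw => rcases hw with rfl | rfl <;> simp [hrot, hrev]
  | one => rfl
  | mul a b _ _ ha hb => exact (hb x).trans (ha (b x))
  | inv a _ ha => simpa using (ha (a⁻¹ x)).symm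

theorem vertex_apply_eq {p : V → α} (hp : ∀ e, p (G.src e) = p (G.tgt e)) (v w : V) :
    p v = p w := by
  obtain ⟨x, rfl⟩ := G.org_surjective v
  obtain ⟨y, rfl⟩ := G.org_surjective w
  refine G.apply_eq_of_rot_of_dartRev (p := p ∘ G.org) (fun x => congrArg p (G.org_rot x)) ?_ x y
  rintro ⟨e, _ | _⟩
  exacts [hp e, (hp e).symm]

theorem face_apply_eq {p : F → α} (hp : ∀ e, p (G.left (e, true)) = p (G.left (e, false)))
    (f f' : F) : p f = p f' := by
  obtain ⟨x, rfl⟩ := G.left_surjective f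
  obtain ⟨y, rfl⟩ := G.left_surjective f'
  have hrev : ∀ x, p (G.left (dartRev E x)) = p (G.left x) := by
    rintro ⟨e, _ | _⟩
    exacts [hp e, (hp e).symm]
  refine G.apply_eq_of_rot_of_dartRev (p := p ∘ G.left) (fun x => ?_) hrev x y
  rw [Function.comp_apply, ← hrev, left_dartRev_rot, Function.comp_apply]

end Connected

section Cohomology

variable (d : ℕ)

theorem coboundary₀_apply [Fintype V] [DecidableEq V] (u : V → ZMod d) (e : E) :
    G.coboundary₀ d u e = u (G.tgt e) - u (G.src e) := by
  simp [coboundary₀, star, mul_sub, Finset.sum_sub_distrib]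

theorem coboundary₁_apply [Fintype E] [DecidableEq F] (c : E → ZMod d) (f : F) :
    G.coboundary₁ d c f = ∑ e, c e * G.faceBoundary d f e := rfl

theorem coboundary₁_single [Fintype E] [DecidableEq E] [DecidableEq F] (e : E) :
    G.coboundary₁ d (Pi.single e 1)
      = Pi.single (G.left (e, true)) 1 - Pi.single (G.left (e, false)) 1 := by
  ext f
  simp [coboundary₁_apply, Pi.single_apply, faceBoundary, eq_comm (a := f)]

open LinearMap

theorem exact_const_coboundary₀ [Fintype V] [DecidableEq V] :
    Function.Exact (toSpanSingleton (ZMod d) (V → ZMod d) 1) (G.coboundary₀ d) := by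
  intro u
  constructor
  · intro hu
    have hconst : ∀ v w, u v = u w := G.vertex_apply_eq fun e =>
      (sub_eq_zero.1 ((G.coboundary₀_apply d u e).symm.trans (congrFun hu e))).symm
    obtain ⟨e⟩ := G.nonempty
    exact ⟨u (G.src e), funext fun v => by simp [hconst v (G.src e)]⟩
  · rintro ⟨r, rfl⟩
    ext e
    simp [coboundary₀_apply]

theorem exact_coboundary₁_sum [Fintype E] [Fintype F] [DecidableEq F] :
    Function.Exact (G.coboundary₁ d) (∑ f, proj f : (F → ZMod d) →ₗ[ZMod d] ZMod d) := by
  classical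
  intro q
  simp only [LinearMap.sum_apply, LinearMap.proj_apply]
  constructor
  · intro hq
    let B := range (G.coboundary₁ d)
    have hface : ∀ f f', B.mkQ (Pi.single f 1) = B.mkQ (Pi.single f' 1) :=
      G.face_apply_eq fun e => (Submodule.Quotient.eq B).2 ⟨Pi.single e 1, G.coboundary₁_single d e⟩
    obtain ⟨e⟩ := G.nonempty
    refine (Submodule.Quotient.mk_eq_zero B).1 ?_
    change B.mkQ q = 0
    calc B.mkQ q = ∑ f, q f • B.mkQ (Pi.single f 1) := by
          conv_lhs => rw [pi_eq_sum_univ' q]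
          simp [Pi.single]
      _ = (∑ f, q f) • B.mkQ (Pi.single (G.left (e, true)) 1) := by
          rw [Finset.sum_smul]
          exact Finset.sum_congr rfl fun f _ => by rw [hface f (G.left (e, true))]
      _ = 0 := by rw [hq, zero_smul]
  · rintro ⟨c, rfl⟩
    simp only [coboundary₁_apply]
    rw [Finset.sum_comm]
    simp [← Finset.mul_sum, faceBoundary]

theorem exists_apply_coboundary₀_eq [Fintype V] [DecidableEq V] (v w : V) :
    ∃ φ : (E → ZMod d) →ₗ[ZMod d] ZMod d, ∀ u, φ (G.coboundary₀ d u) = u w - u v := by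
  -- `φ` is summation along a path from `v` to `w`; the quotient by `B` avoids choosing one.
  let B := range ((G.coboundary₀ d).lcomp (ZMod d) (ZMod d))
  let ev (v : V) : (V → ZMod d) →ₗ[ZMod d] ZMod d := proj v
  have hev (e : E) : B.mkQ (ev (G.src e)) = B.mkQ (ev (G.tgt e)) := by
    refine ((Submodule.Quotient.eq B).2 ⟨proj e, ?_⟩).symm
    exact LinearMap.ext fun u => G.coboundary₀_apply d u e
  have hvw : B.mkQ (ev w) = B.mkQ (ev v) := G.vertex_apply_eq (p := B.mkQ ∘ ev) hev w v
  obtain ⟨φ, hφ⟩ := (Submodule.Quotient.eq B).1 hvw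
  exact ⟨φ, LinearMap.congr_fun hφ⟩

theorem exists_retraction_coboundaries [Fintype V] [DecidableEq V] :
    ∃ r : (E → ZMod d) →ₗ[ZMod d] G.coboundaries d, ∀ b : G.coboundaries d, r b = b := by
  obtain ⟨e⟩ := G.nonempty
  choose φ hφ using G.exists_apply_coboundary₀_eq d (G.src e)
  -- On a coboundary, `pi φ` recovers the potential that vanishes at `G.src e`.
  refine ⟨(G.coboundary₀ d).rangeRestrict ∘ₗ pi φ, ?_⟩
  rintro ⟨_, u, rfl⟩
  have hu : pi φ (G.coboundary₀ d u) = fun v => u v - u (G.src e) :=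
    funext fun v => hφ v u
  ext e'
  change G.coboundary₀ d (pi φ (G.coboundary₀ d u)) e' = G.coboundary₀ d u e'
  simp [hu, coboundary₀_apply]

theorem nonempty_zeroCochains_linearEquiv [Fintype V] [DecidableEq V] :
    Nonempty ((V → ZMod d) ≃ₗ[ZMod d] ZMod d × G.coboundaries d) := by
  obtain ⟨e⟩ := G.nonempty
  have hexact : Function.Exact (toSpanSingleton (ZMod d) (V → ZMod d) 1)
      (G.coboundary₀ d).rangeRestrict := by
    rw [exact_iff, ker_rangeRestrict, ← exact_iff]
    exact G.exact_const_coboundary₀ d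
  exact ⟨(hexact.splitInjectiveEquiv (surjective_rangeRestrict _)
    ⟨proj (G.src e), by ext; simp⟩).1⟩

theorem nonempty_twoCochains_linearEquiv [Fintype E] [Finite F] [DecidableEq F] :
    Nonempty ((F → ZMod d) ≃ₗ[ZMod d] range (G.coboundary₁ d) × ZMod d) := by
  have := Fintype.ofFinite F
  obtain ⟨e⟩ := G.nonempty
  have hexact : Function.Exact (range (G.coboundary₁ d)).subtype
      (∑ f, proj f : (F → ZMod d) →ₗ[ZMod d] ZMod d) := by
    rw [exact_iff, Submodule.range_subtype, ← exact_iff]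
    exact G.exact_coboundary₁_sum d
  exact ⟨(hexact.splitSurjectiveEquiv (Submodule.subtype_injective _)
    ⟨single (ZMod d) (fun _ : F => ZMod d) (G.left (e, true)), by ext; simp⟩).1⟩

theorem nonempty_H1_prod_linearEquiv
    [Fintype V] [Fintype E] [Finite F] [DecidableEq V] [DecidableEq F] :
    Nonempty ((G.H1 d × ((V → ZMod d) × (F → ZMod d)))
      ≃ₗ[ZMod d] (E → ZMod d) × (ZMod d × ZMod d)) := by
  obtain ⟨e₀⟩ := G.nonempty_zeroCochains_linearEquiv d
  obtain ⟨e₂⟩ := G.nonempty_twoCochains_linearEquiv d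
  have : Module.Projective (ZMod d) (range (G.coboundary₁ d)) :=
    .of_split (e₂.symm.toLinearMap ∘ₗ inl _ _ _) (fst _ _ _ ∘ₗ e₂.toLinearMap) (by ext; simp)
  obtain ⟨e₁⟩ := nonempty_linearEquiv_ker_prod_range (G.coboundary₁ d)
  obtain ⟨r, hr⟩ := G.exists_retraction_coboundaries d
  obtain ⟨eZ⟩ := nonempty_linearEquiv_prod_of_retraction _ _ (G.coboundaries_le_cocycles d) r hr
  let shuffle : (G.H1 d × ((ZMod d × G.coboundaries d) × (range (G.coboundary₁ d) × ZMod d)))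
      ≃ₗ[ZMod d] ((G.coboundaries d × G.H1 d) × range (G.coboundary₁ d)) × (ZMod d × ZMod d) :=
    { toFun := fun ⟨h, (s, b), (c, t)⟩ => (((b, h), c), (s, t))
      invFun := fun ⟨((b, h), c), (s, t)⟩ => (h, (s, b), (c, t))
      map_add' := fun _ _ => rfl
      map_smul' := fun _ _ => rfl }
  exact ⟨((LinearEquiv.refl _ _).prodCongr (e₀.prodCongr e₂)).trans <| shuffle.trans <|
    ((e₁.trans (eZ.prodCongr (.refl _ _))).symm).prodCongr (.refl _ _)⟩

theorem nonempty_linearEquiv_H1 [Fintype V] [Fintype E] [Fintype F] [DecidableEq V] [DecidableEq F]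
    [NeZero d] {g : ℕ} (hg : G.HasGenus g) :
    Nonempty (((Fin g → ZMod d) × (Fin g → ZMod d)) ≃ₗ[ZMod d] G.H1 d) := by
  obtain ⟨e⟩ := G.nonempty_H1_prod_linearEquiv d
  let bR := Module.Basis.singleton Unit (ZMod d)
  have hcard : Fintype.card (E ⊕ (Unit ⊕ Unit))
      = Fintype.card (Fin g ⊕ Fin g) + Fintype.card (V ⊕ F) := by
    rw [HasGenus] at hg
    simp only [Fintype.card_sum, Fintype.card_unit, Fintype.card_fin]
    omega
  obtain ⟨b⟩ := nonempty_basis_of_prod_linearEquiv (κ := Fin g ⊕ Fin g)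
    ((Pi.basisFun _ V).prod (Pi.basisFun _ F)) ((Pi.basisFun _ E).prod (bR.prod bR)) e hcard
  exact ⟨(b.equivFun.trans (LinearEquiv.sumArrowLequivProdArrow _ _ (ZMod d) (ZMod d))).symm⟩

end Cohomology

end PolygonDecomposition

/-! ### Ground states of sums of contractions -/

section StrictConvexSpace

variable {ι : Type*}

theorem sum_eq_card_nsmul_iff {H : Type*} [NormedAddCommGroup H] [NormedSpace ℝ H]
    [StrictConvexSpace ℝ H] {s : Finset ι} {y : ι → H} {x : H} (hy : ∀ i ∈ s, ‖y i‖ ≤ ‖x‖) :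
    ∑ i ∈ s, y i = s.card • x ↔ ∀ i ∈ s, y i = x := by
  classical
  refine ⟨fun hsum i hi => ?_, fun h => by rw [Finset.sum_congr rfl h, Finset.sum_const]⟩
  have hadd : x + y i = (s.card + 1) • x - ∑ j ∈ s.erase i, y j := by
    rw [succ_nsmul, ← hsum, ← Finset.add_sum_erase s y hi]
    abel
  have hrest : ‖∑ j ∈ s.erase i, y j‖ ≤ (s.card - 1) * ‖x‖ := by
    refine (norm_sum_le_of_le _ fun j hj => hy j (Finset.mem_of_mem_erase hj)).trans_eq ?_
    rw [Finset.sum_const, nsmul_eq_mul, Finset.cast_card_erase_of_mem hi]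
  have hlower : ‖x‖ + ‖x‖ ≤ ‖x + y i‖ := by
    have hsub := norm_sub_norm_le ((s.card + 1) • x) (∑ j ∈ s.erase i, y j)
    rw [← hadd, RCLike.norm_nsmul ℝ, nsmul_eq_mul] at hsub
    push_cast at hsub
    linarith
  -- So `x` and `y i` have equal norms and equality holds in the triangle inequality.
  have hupper := norm_add_le x (y i)
  exact (eq_of_norm_eq_of_norm_add_eq (by linarith [hy i hi]) (by linarith [hy i hi])).symm

section Contractions

variable [Fintype ι] {H : Type*} [NormedAddCommGroup H]

theorem neg_card_le_of_hasEigenvalue_neg_sum {𝕜 : Type*} [RCLike 𝕜] [NormedSpace 𝕜 H]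
    {T : ι → Module.End 𝕜 H} (hT : ∀ i ψ, ‖T i ψ‖ ≤ ‖ψ‖) {x : ℝ}
    (hx : (-∑ i, T i).HasEigenvalue (x : 𝕜)) :
    -(Fintype.card ι : ℝ) ≤ x := by
  obtain ⟨ψ, hψ⟩ := hx.exists_hasEigenvector
  have hnorm : |x| * ‖ψ‖ ≤ Fintype.card ι * ‖ψ‖ := by
    calc |x| * ‖ψ‖ = ‖∑ i, T i ψ‖ := by
          rw [← norm_neg (∑ i, T i ψ), ← LinearMap.sum_apply, ← LinearMap.neg_apply,
            hψ.apply_eq_smul, norm_smul, RCLike.norm_ofReal]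
      _ ≤ ∑ _i : ι, ‖ψ‖ := norm_sum_le_of_le _ fun i _ => hT i ψ
      _ = Fintype.card ι * ‖ψ‖ := by simp
  exact (abs_le.1 (le_of_mul_le_mul_right hnorm (norm_pos_iff.2 hψ.2))).1

theorem neg_sum_apply_eq_iff {R : Type*} [Ring R] [Module R H] [NormedSpace ℝ H]
    [StrictConvexSpace ℝ H] {T : ι → Module.End R H} {ψ : H} (hT : ∀ i, ‖T i ψ‖ ≤ ‖ψ‖) :
    (-∑ i, T i) ψ = (-(Fintype.card ι : R)) • ψ ↔ ∀ i, T i ψ = ψ := by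
  rw [LinearMap.neg_apply, neg_smul, neg_inj, LinearMap.sum_apply, Nat.cast_smul_eq_nsmul,
    ← Finset.card_univ, sum_eq_card_nsmul_iff fun i _ => hT i]
  simp

end Contractions

end StrictConvexSpace

section GroundStates

variable {E : Type*} [Fintype E] [DecidableEq E] {d : ℕ} [NeZero d]
variable {ι : Type*} [Fintype ι] {T : ι → Module.End ℂ (StateSpace E d)}

theorem groundEnergy_neg_sum (hT : ∀ i ψ, ‖T i ψ‖ ≤ ‖ψ‖) {φ : StateSpace E d} (hφ : φ ≠ 0)
    (hfix : ∀ i, T i φ = φ) : groundEnergy (-∑ i, T i) = -(Fintype.card ι : ℝ) := by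
  refine IsLeast.csInf_eq ⟨?_, fun x hx => neg_card_le_of_hasEigenvalue_neg_sum hT hx⟩
  refine Module.End.hasEigenvalue_of_hasEigenvector ⟨?_, hφ⟩
  rw [Module.End.mem_eigenspace_iff]
  exact_mod_cast (neg_sum_apply_eq_iff (hT · φ)).2 hfix

theorem mem_eigenspace_groundEnergy_neg_sum_iff (hT : ∀ i ψ, ‖T i ψ‖ ≤ ‖ψ‖) {φ : StateSpace E d}
    (hφ : φ ≠ 0) (hfix : ∀ i, T i φ = φ) {ψ : StateSpace E d} :
    ψ ∈ (-∑ i, T i).eigenspace (groundEnergy (-∑ i, T i) : ℂ) ↔ ∀ i, T i ψ = ψ := by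
  rw [groundEnergy_neg_sum hT hφ hfix, Module.End.mem_eigenspace_iff]
  exact_mod_cast neg_sum_apply_eq_iff (hT · ψ)

end GroundStates

section Operators

variable {E : Type*} [Fintype E] [DecidableEq E] {d : ℕ} [NeZero d]

theorem powerAverage_apply (u : StateSpace E d ≃ₗᵢ[ℂ] StateSpace E d) (ψ : StateSpace E d) :
    powerAverage u ψ = (d : ℂ)⁻¹ • ∑ j ∈ Finset.range d, (u ^ j) ψ := by
  simp [powerAverage]

theorem norm_powerAverage_apply_le (u : StateSpace E d ≃ₗᵢ[ℂ] StateSpace E d)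
    (ψ : StateSpace E d) : ‖powerAverage u ψ‖ ≤ ‖ψ‖ := by
  have hd : (0 : ℝ) < d := Nat.cast_pos.2 (NeZero.pos d)
  have hsum : ‖∑ j ∈ Finset.range d, (u ^ j) ψ‖ ≤ d * ‖ψ‖ :=
    (norm_sum_le_of_le _ fun j _ => ((u ^ j).norm_map ψ).le).trans_eq (by simp)
  rw [powerAverage_apply, norm_smul, norm_inv, Complex.norm_natCast]
  exact (inv_mul_le_iff₀ hd).2 hsum

theorem powerAverage_apply_eq_self_iff {u : StateSpace E d ≃ₗᵢ[ℂ] StateSpace E d}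
    (hu : u ^ d = 1) {ψ : StateSpace E d} : powerAverage u ψ = ψ ↔ u ψ = ψ := by
  have hd : (d : ℂ) ≠ 0 := NeZero.ne _
  have hsum := sum_eq_card_nsmul_iff (s := Finset.range d) fun j _ => ((u ^ j).norm_map ψ).le
  rw [Finset.card_range] at hsum
  rw [powerAverage_apply, inv_smul_eq_iff₀ hd, Nat.cast_smul_eq_nsmul, hsum]
  constructor
  · intro h
    have h1 : (u ^ (1 % d)) ψ = ψ := h _ (Finset.mem_range.2 (Nat.mod_lt _ (NeZero.pos d)))
    rwa [← pow_eq_pow_mod 1 hu, pow_one] at h1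
  · rintro h j -
    induction j with
    | zero => rfl
    | succ j ih => rw [pow_succ, op_mul_apply, h, ih]

theorem omega_pow_eq_one_iff (n : ℕ) : (omega d : ℂ) ^ n = 1 ↔ (n : ZMod d) = 0 := by
  rw [ZMod.natCast_eq_zero_iff]
  exact (Complex.isPrimitiveRoot_exp d (NeZero.ne d)).pow_eq_one_iff_dvd n

theorem opX_productState (γ k : E → ZMod d) :
    opX γ (productState k) = productState (k + γ) := by
  ext m
  simp [opX_apply, productState, sub_eq_iff_eq_add]

theorem opXHom_injective : Function.Injective (opXHom (E := E) (d := d)) := by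
  refine (injective_iff_map_eq_one _).2 fun γ hγ => ?_
  have hfix : opX γ.toAdd (productState 0) = productState 0 :=
    DFunLike.congr_fun hγ (productState 0)
  rw [opX_productState, zero_add] at hfix
  by_contra hne
  have hvalue : (productState γ.toAdd : StateSpace E d) γ.toAdd = 0 := by
    rw [hfix]
    exact Pi.single_eq_of_ne (fun h => hne h) _
  simp [productState] at hvalue

theorem opX_pow_card (γ : E → ZMod d) : opX γ ^ d = 1 := by
  have hpow : Multiplicative.ofAdd γ ^ d = 1 := by
    rw [← ofAdd_nsmul, ← Nat.cast_smul_eq_nsmul (ZMod d), CharP.cast_eq_zero, zero_smul, ofAdd_zero]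
  exact (map_pow opXHom (Multiplicative.ofAdd γ) d).symm.trans (by rw [hpow, map_one])

theorem opZ_pow_apply (γ : E → ZMod d) (n : ℕ) (ψ : StateSpace E d) (k : E → ZMod d) :
    (opZ γ ^ n) ψ k = ((omega d : ℂ) ^ ∑ e, (k e).val * (γ e).val) ^ n * ψ k := by
  induction n generalizing ψ with
  | zero => simp
  | succ n ih => rw [pow_succ, op_mul_apply, ih, opZ_apply, pow_succ, mul_assoc]

theorem opZ_pow_card (γ : E → ZMod d) : opZ γ ^ d = 1 := by
  ext ψ k
  have homega : (omega d : ℂ) ^ d = 1 := (omega_pow_eq_one_iff d).2 (CharP.cast_eq_zero _ _)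
  rw [opZ_pow_apply, pow_right_comm, homega, one_pow, one_mul]
  rfl

theorem opX_apply_eq_self_iff {γ : E → ZMod d} {ψ : StateSpace E d} :
    opX γ ψ = ψ ↔ ∀ k, ψ (k - γ) = ψ k := by
  simp [PiLp.ext_iff, opX_apply]

theorem opZ_apply_eq_self_iff {γ : E → ZMod d} {ψ : StateSpace E d} :
    opZ γ ψ = ψ ↔ ∀ k : E → ZMod d, ∑ e, k e * γ e ≠ 0 → ψ k = 0 := by
  have hphase (k : E → ZMod d) :
      (omega d : ℂ) ^ (∑ e, (k e).val * (γ e).val) = 1 ↔ ∑ e, k e * γ e = 0 := by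
    rw [omega_pow_eq_one_iff]
    simp
  rw [PiLp.ext_iff]
  refine forall_congr' fun k => ?_
  rw [opZ_apply, mul_left_eq_self₀, hphase, or_iff_not_imp_left]

end Operators

/-! ### Coset states -/

section CosetStates

variable (𝕜 : Type*) [RCLike 𝕜] {A : Type*} [AddCommGroup A] (B : AddSubgroup A)

open Classical in
/-- The normalised indicator function of the coset `a + B`, as a vector of `ℓ²(A)`.  For the group
`B` of coboundaries these are the candidate ground states `X_a Ψ₀`. -/
def cosetState (a : A) : EuclideanSpace 𝕜 A :=
  WithLp.toLp 2 fun k => if k - a ∈ B then (√(Nat.card B) : 𝕜)⁻¹ else 0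

open Classical in
theorem cosetState_apply (a k : A) :
    cosetState 𝕜 B a k = if k - a ∈ B then (√(Nat.card B) : 𝕜)⁻¹ else 0 := rfl

variable {𝕜 B}

theorem cosetState_eq_of_sub_mem {a a' : A} (h : a - a' ∈ B) :
    cosetState 𝕜 B a = cosetState 𝕜 B a' := by
  classical
  ext k
  refine if_congr ?_ rfl rfl
  rw [← sub_add_sub_cancel k a a', B.add_mem_cancel_right h]

theorem cosetState_apply_sub {a b : A} (hb : b ∈ B) (k : A) :
    cosetState 𝕜 B a (k - b) = cosetState 𝕜 B a k := by
  classical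
  refine if_congr ?_ rfl rfl
  rw [sub_right_comm, sub_eq_add_neg, B.add_mem_cancel_right (neg_mem hb)]

section Fintype

variable [Fintype A]

theorem card_filter_sub_mem (a : A) [DecidablePred fun k => k - a ∈ B] :
    Finset.card {k | k - a ∈ B} = Nat.card B := by
  rw [← Fintype.card_subtype, Fintype.card_eq_nat_card]
  exact Nat.card_congr ((Equiv.subRight a).subtypeEquiv fun _ => Iff.rfl)

theorem norm_cosetState (a : A) : ‖cosetState 𝕜 B a‖ = 1 := by
  classical
  have hcard : (Nat.card B : ℝ) ≠ 0 := Nat.cast_ne_zero.2 Nat.card_pos.ne'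
  rw [← sq_eq_sq₀ (norm_nonneg _) zero_le_one, EuclideanSpace.norm_sq_eq]
  calc ∑ k, ‖cosetState 𝕜 B a k‖ ^ 2 = ∑ k with k - a ∈ B, (Nat.card B : ℝ)⁻¹ := by
        simp only [cosetState_apply, Finset.sum_filter, apply_ite norm, ite_pow, norm_inv,
          RCLike.norm_ofReal, abs_of_nonneg (Real.sqrt_nonneg _), inv_pow,
          Real.sq_sqrt (Nat.cast_nonneg _), norm_zero, zero_pow two_ne_zero]
    _ = 1 ^ 2 := by
        rw [Finset.sum_const, card_filter_sub_mem, nsmul_eq_mul, mul_inv_cancel₀ hcard, one_pow]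

theorem inner_cosetState_of_sub_notMem {a a' : A} (h : a - a' ∉ B) :
    inner 𝕜 (cosetState 𝕜 B a) (cosetState 𝕜 B a') = 0 := by
  rw [PiLp.inner_apply]
  refine Finset.sum_eq_zero fun k _ => ?_
  by_cases hk : k - a ∈ B
  · have hk' : k - a' ∉ B := fun hk' => h (by simpa using B.sub_mem hk' hk)
    simp [cosetState_apply, hk']
  · simp [cosetState_apply, hk]

theorem orthonormal_cosetState {ι : Type*} {γ : ι → A} (hγ : Pairwise fun i j => γ i - γ j ∉ B) :
    Orthonormal 𝕜 fun i => cosetState 𝕜 B (γ i) :=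
  ⟨fun i => norm_cosetState (γ i), fun _ _ hij => inner_cosetState_of_sub_notMem (hγ hij)⟩

theorem sum_apply_smul_cosetState {ψ : EuclideanSpace 𝕜 A} (hψ : ∀ b ∈ B, ∀ k, ψ (k - b) = ψ k) :
    ∑ k, ψ k • cosetState 𝕜 B k = (√(Nat.card B) : 𝕜) • ψ := by
  classical
  have hterm (k m : A) : ψ k * cosetState 𝕜 B k m
      = if k - m ∈ B then (√(Nat.card B) : 𝕜)⁻¹ * ψ m else 0 := by
    rw [cosetState_apply, sub_mem_comm_iff]
    split_ifs with h
    · rw [← hψ _ h k, sub_sub_cancel, mul_comm]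
    · exact mul_zero _
  ext m
  calc (∑ k, ψ k • cosetState 𝕜 B k) m
      = ∑ k with k - m ∈ B, (√(Nat.card B) : 𝕜)⁻¹ * ψ m := by
        simp only [WithLp.ofLp_sum, Finset.sum_apply, PiLp.smul_apply, smul_eq_mul, hterm,
          Finset.sum_filter]
    _ = (√(Nat.card B) : 𝕜) * ψ m := by
        have hsqrt : (Nat.card B : 𝕜) = √(Nat.card B) * √(Nat.card B) := by
          rw [← RCLike.ofReal_mul, Real.mul_self_sqrt (Nat.cast_nonneg _), RCLike.ofReal_natCast]
        have hne : (√(Nat.card B) : 𝕜) ≠ 0 := by simp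
        rw [Finset.sum_const, card_filter_sub_mem, nsmul_eq_mul, hsqrt, mul_assoc,
          mul_inv_cancel_left₀ hne]

end Fintype

theorem mem_span_range_cosetState_iff [Finite A] {ι : Type*} {γ : ι → A} {ψ : EuclideanSpace 𝕜 A} :
    ψ ∈ Submodule.span 𝕜 (Set.range fun i => cosetState 𝕜 B (γ i)) ↔
      (∀ b ∈ B, ∀ k, ψ (k - b) = ψ k) ∧ ∀ k, (∀ i, k - γ i ∉ B) → ψ k = 0 := by
  constructor
  · intro hψ
    induction hψ using Submodule.span_induction with
    | mem φ hφ =>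
      obtain ⟨i, rfl⟩ := hφ
      exact ⟨fun b hb => cosetState_apply_sub hb, fun k hk => if_neg (hk i)⟩
    | zero => simp
    | add φ χ _ _ hφ hχ =>
      exact ⟨fun b hb k => congrArg₂ (· + ·) (hφ.1 b hb k) (hχ.1 b hb k),
        fun k hk => by simp [hφ.2 k hk, hχ.2 k hk]⟩
    | smul c φ _ hφ =>
      exact ⟨fun b hb k => congrArg (c * ·) (hφ.1 b hb k), fun k hk => by simp [hφ.2 k hk]⟩
  · rintro ⟨hinv, hsupp⟩
    have := Fintype.ofFinite A
    have hne : (√(Nat.card B) : 𝕜) ≠ 0 := by simp [Nat.card_pos.ne']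
    rw [← inv_smul_smul₀ hne ψ, ← sum_apply_smul_cosetState hinv]
    refine Submodule.smul_mem _ _ (Submodule.sum_mem _ fun k _ => ?_)
    by_cases hk : ∀ i, k - γ i ∉ B
    · simp [hsupp k hk]
    · push Not at hk
      obtain ⟨i, hi⟩ := hk
      exact Submodule.smul_mem _ _ (Submodule.subset_span ⟨i, (cosetState_eq_of_sub_mem hi).symm⟩)

end CosetStates

namespace PolygonDecomposition

variable {V E F : Type*} (G : PolygonDecomposition V E F)

section VertexGroup

variable (d : ℕ) [Fintype V] [DecidableEq V]

theorem coboundaries_toAddSubgroup :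
    (G.coboundaries d).toAddSubgroup = AddSubgroup.closure (Set.range (G.star d)) := by
  refine le_antisymm ?_ ((AddSubgroup.closure_le _).2 ?_)
  · rintro _ ⟨u, rfl⟩
    exact sum_mem fun v _ =>
      ZMod.smul_mem (AddSubgroup.subset_closure (Set.mem_range_self v)) (u v)
  · rintro _ ⟨v, rfl⟩
    exact ⟨Pi.single v 1, by simp [coboundary₀, Pi.single_apply]⟩

variable [NeZero d] [Fintype E] [DecidableEq E]

theorem vertexGroup_eq_map :
    G.vertexGroup d = (G.coboundaries d).toAddSubgroup.toSubgroup.map opXHom := by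
  rw [coboundaries_toAddSubgroup, AddSubgroup.toSubgroup_closure, MonoidHom.map_closure,
    vertexGroup]
  congr 1
  ext u
  simp [vertexUnitary, opXHom]

/-- The isomorphism `b ↦ X_b` from the coboundaries onto the group `K` of the `a_v`. -/
def coboundariesEquivVertexGroup : G.coboundaries d ≃ G.vertexGroup d :=
  (((G.coboundaries d).toAddSubgroup.toSubgroup.equivMapOfInjective opXHom opXHom_injective).trans
    (MulEquiv.subgroupCongr (G.vertexGroup_eq_map d).symm)).toEquiv

theorem coe_coboundariesEquivVertexGroup (b : G.coboundaries d) :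
    (G.coboundariesEquivVertexGroup d b : StateSpace E d ≃ₗᵢ[ℂ] StateSpace E d) = opX b := rfl

theorem opX_Psi₀ (γ : E → ZMod d) :
    opX γ (G.Psi₀ d) = cosetState ℂ (G.coboundaries d).toAddSubgroup γ := by
  classical
  have hcard : Fintype.card (G.vertexGroup d) = Nat.card (G.coboundaries d) := by
    rw [← Nat.card_eq_fintype_card, Nat.card_congr (G.coboundariesEquivVertexGroup d)]
  have hnorm : (Nat.card (G.coboundaries d) : ℝ) ^ (-(1 / 2) : ℝ)
      = (√(Nat.card (G.coboundaries d)))⁻¹ := by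
    rw [Real.rpow_neg (Nat.cast_nonneg _), Real.sqrt_eq_rpow]
  have hsum (k : E → ZMod d) : ∑ b : G.coboundaries d, productState (E := E) (b : E → ZMod d) k
      = if k ∈ G.coboundaries d then 1 else 0 := by
    split_ifs with hk
    · rw [Fintype.sum_eq_single ⟨k, hk⟩ fun b hb => ?_]
      · simp [productState]
      · exact Pi.single_eq_of_ne (fun h => hb (Subtype.ext h.symm)) _
    · exact Finset.sum_eq_zero fun b _ =>
        Pi.single_eq_of_ne (fun h : k = b => hk (h ▸ b.2)) _
  ext k
  rw [opX_apply, Psi₀, ← (G.coboundariesEquivVertexGroup d).sum_comp, hcard, hnorm]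
  simp only [coe_coboundariesEquivVertexGroup, opX_productState, zero_add, PiLp.smul_apply,
    WithLp.ofLp_sum, Finset.sum_apply, hsum, cosetState_apply]
  simp

end VertexGroup

section GroundStates

variable (d : ℕ) [NeZero d] [Fintype E] [DecidableEq E]

/-- The unitaries `a_v` and `b_f` as a single family: the ground states are the vectors they all
fix. -/
def stabilizer [DecidableEq V] [DecidableEq F] : V ⊕ F → StateSpace E d ≃ₗᵢ[ℂ] StateSpace E d :=
  Sum.elim (G.vertexUnitary d) (G.faceUnitary d)

theorem stabilizer_pow_card [DecidableEq V] [DecidableEq F] (i : V ⊕ F) :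
    G.stabilizer d i ^ d = 1 := by
  rcases i with v | f
  exacts [opX_pow_card _, opZ_pow_card _]

theorem hamiltonian_eq_neg_sum [Fintype V] [Fintype F] [DecidableEq V] [DecidableEq F] :
    G.hamiltonian d = -∑ i, powerAverage (G.stabilizer d i) := by
  rw [hamiltonian, Fintype.sum_sum_type, neg_add']
  rfl

variable {d}

theorem forall_vertexUnitary_apply_eq_self_iff [Fintype V] [DecidableEq V] {ψ : StateSpace E d} :
    (∀ v, G.vertexUnitary d v ψ = ψ) ↔ ∀ b ∈ G.coboundaries d, ∀ k, ψ (k - b) = ψ k := by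
  simp only [vertexUnitary, opX_apply_eq_self_iff, ← Submodule.mem_toAddSubgroup,
    coboundaries_toAddSubgroup]
  refine ⟨fun h b hb => ?_, fun h v => h _ (AddSubgroup.subset_closure ⟨v, rfl⟩)⟩
  induction hb using AddSubgroup.closure_induction with
  | mem _ hb =>
    obtain ⟨v, rfl⟩ := hb
    exact h v
  | zero => simp
  | add a b _ _ ha hb => exact fun k => by rw [← sub_sub, hb, ha]
  | neg a _ ha => exact fun k => by rw [← ha, sub_neg_eq_add, add_sub_cancel_right]

theorem forall_faceUnitary_apply_eq_self_iff [DecidableEq F] {ψ : StateSpace E d} :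
    (∀ f, G.faceUnitary d f ψ = ψ) ↔ ∀ k ∉ G.cocycles d, ψ k = 0 := by
  simp only [faceUnitary, opZ_apply_eq_self_iff, cocycles, LinearMap.mem_ker, funext_iff,
    not_forall, forall_exists_index]
  exact forall_comm

theorem forall_stabilizer_apply_eq_self_iff [Fintype V] [DecidableEq V] [DecidableEq F]
    {ψ : StateSpace E d} :
    (∀ i, G.stabilizer d i ψ = ψ) ↔
      (∀ b ∈ G.coboundaries d, ∀ k, ψ (k - b) = ψ k) ∧ ∀ k ∉ G.cocycles d, ψ k = 0 := by
  rw [Sum.forall, ← forall_vertexUnitary_apply_eq_self_iff, ← forall_faceUnitary_apply_eq_self_iff]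
  rfl

theorem exists_ne_zero_forall_stabilizer_apply_eq_self
    [Finite V] [DecidableEq V] [DecidableEq F] :
    ∃ φ : StateSpace E d, φ ≠ 0 ∧ ∀ i, G.stabilizer d i φ = φ := by
  have := Fintype.ofFinite V
  refine ⟨cosetState ℂ (G.coboundaries d).toAddSubgroup 0, ?_, ?_⟩
  · exact norm_ne_zero_iff.1 (by rw [norm_cosetState]; exact one_ne_zero)
  · refine G.forall_stabilizer_apply_eq_self_iff.2
      ⟨fun b hb => cosetState_apply_sub hb, fun k hk => if_neg fun h => hk ?_⟩
    simpa using G.coboundaries_le_cocycles d h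

theorem mem_groundStateSpace_iff [Fintype V] [Fintype F] [DecidableEq V] [DecidableEq F]
    {ψ : StateSpace E d} :
    ψ ∈ G.groundStateSpace d ↔
      (∀ b ∈ G.coboundaries d, ∀ k, ψ (k - b) = ψ k) ∧ ∀ k ∉ G.cocycles d, ψ k = 0 := by
  have hfix (i : V ⊕ F) (χ : StateSpace E d) :
      powerAverage (G.stabilizer d i) χ = χ ↔ G.stabilizer d i χ = χ :=
    powerAverage_apply_eq_self_iff (G.stabilizer_pow_card d i)
  obtain ⟨φ, hφ, hφfix⟩ := G.exists_ne_zero_forall_stabilizer_apply_eq_self (d := d)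
  rw [groundStateSpace, hamiltonian_eq_neg_sum, mem_eigenspace_groundEnergy_neg_sum_iff
    (fun i => norm_powerAverage_apply_le _) hφ fun i => (hfix i φ).2 (hφfix i)]
  simp only [hfix, forall_stabilizer_apply_eq_self_iff]

end GroundStates

section Basis

variable {d : ℕ} [Fintype V] [Fintype E] [DecidableEq V] [DecidableEq F]

theorem cohomologyClass_eq_iff {c c' : G.cocycles d} :
    G.cohomologyClass d c = G.cohomologyClass d c' ↔ (c - c' : E → ZMod d) ∈ G.coboundaries d :=
  Submodule.Quotient.eq _

variable [NeZero d] [DecidableEq E] {ι : Type*} {γ : ι → G.cocycles d}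

theorem orthonormal_opX_Psi₀ (hγ : Function.Injective fun i => G.cohomologyClass d (γ i)) :
    Orthonormal ℂ fun i => opX (γ i : E → ZMod d) (G.Psi₀ d) := by
  simp only [opX_Psi₀]
  exact orthonormal_cosetState fun i j hij h => hij (hγ (G.cohomologyClass_eq_iff.2 h))

theorem span_range_opX_Psi₀ [Fintype F]
    (hγ : Function.Surjective fun i => G.cohomologyClass d (γ i)) :
    Submodule.span ℂ (Set.range fun i => opX (γ i : E → ZMod d) (G.Psi₀ d))
      = G.groundStateSpace d := by
  have hcocycle (k : E → ZMod d) :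
      k ∈ G.cocycles d ↔ ∃ i, k - γ i ∈ (G.coboundaries d).toAddSubgroup := by
    refine ⟨fun hk => ?_, fun ⟨i, hi⟩ => ?_⟩
    · obtain ⟨i, hi⟩ := hγ (G.cohomologyClass d ⟨k, hk⟩)
      exact ⟨i, G.cohomologyClass_eq_iff.1 hi.symm⟩
    · simpa using add_mem (G.coboundaries_le_cocycles d hi) (γ i).2
  ext ψ
  simp only [opX_Psi₀, mem_span_range_cosetState_iff, mem_groundStateSpace_iff, hcocycle,
    not_exists, Submodule.mem_toAddSubgroup]

end Basis

end PolygonDecomposition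

end KitaevModel

end

theorem mainTheorem7_general {V E F : Type*} [Fintype V] [Fintype E] [Fintype F]
    [DecidableEq V] [DecidableEq E] [DecidableEq F]
    (G : KitaevModel.PolygonDecomposition V E F) (g : ℕ) (hg : G.HasGenus g)
    (d : ℕ) [NeZero d] :
    Nonempty (((Fin g → ZMod d) × (Fin g → ZMod d)) ≃ₗ[ZMod d] G.H1 d) ∧
    ∀ {ι : Type*} (γ : ι → G.cocycles d),
      Function.Bijective (fun i => G.cohomologyClass d (γ i)) →
        Orthonormal ℂ (fun i => KitaevModel.opX (γ i : E → ZMod d) (G.Psi₀ d)) ∧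
        Submodule.span ℂ
            (Set.range (fun i => KitaevModel.opX (γ i : E → ZMod d) (G.Psi₀ d))) =
          G.groundStateSpace d :=
  ⟨G.nonempty_linearEquiv_H1 d hg, fun _ hγ =>
    ⟨G.orthonormal_opX_Psi₀ hγ.injective, G.span_range_opX_Psi₀ hγ.surjective⟩⟩

theorem mainTheorem7 {V E F : Type*} [Fintype V] [Fintype E] [Fintype F]
    [DecidableEq V] [DecidableEq E] [DecidableEq F]
    (G : KitaevModel.PolygonDecomposition V E F) (g : ℕ) (hg : G.HasGenus g)
    (d : ℕ) [NeZero d] :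
    Nonempty (((Fin g → ZMod d) × (Fin g → ZMod d)) ≃+ G.H1 d) ∧
    ∀ (θ : ((Fin g → ZMod d) × (Fin g → ZMod d)) ≃+ G.H1 d)
      (γ : (Fin g → ZMod d) × (Fin g → ZMod d) → G.cocycles d),
      (∀ p, G.cohomologyClass d (γ p) = θ p) →
        Orthonormal ℂ (fun p => KitaevModel.opX (γ p : E → ZMod d) (G.Psi₀ d)) ∧
        Submodule.span ℂ
            (Set.range (fun p => KitaevModel.opX (γ p : E → ZMod d) (G.Psi₀ d))) =
          G.groundStateSpace d := by
  obtain ⟨⟨e⟩, hbasis⟩ := mainTheorem7_general G g hg d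
  exact ⟨⟨e.toAddEquiv⟩, fun θ γ hγ => hbasis γ (by simpa only [hγ] using θ.bijective)⟩
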